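/- Work in $\mathbb R^n$. For a Lebesgue measurable set $F$, let $\operatorname{Per}(F)\in[0,\infty]$ be its (De Giorgi) perimeter, i.e. the supremum of $\int_F\operatorname{div}\varphi$ over all $\varphi\in C^1_c(\mathbb R^n;\mathbb R^n)$ with $|\varphi|\le 1$, and let $d_E$ be the signed distance function to a set $E$, positive outside $E$ and negative inside. A set $E\subset\mathbb R^n$ is called a minimizing hull if $|\partial E|=0$ and $\operatorname{Per}(E)\le\operatorname{Per}(F)$ for every $F\supset E$ with $F\setminus E$ compact. Given $h>0$, a set $E$ and an obstacle $\Omega\subset\mathbb R^n$, consider the problem $$\min\Big\{\operatorname{Per}(F)+\frac1h\int_{F\Delta E}|d_E|\,dx \;:\; F \text{ of finite perimeter},\ \Omega\subset F\Big\}.\qquad(P_\Omega)$$ A minimizer of $(P_\Omega)$ is called maximal if it contains every other minimizer of $(P_\Omega)$ up to a Lebesgue null set. Let $h>0$ and let $E$ be a minimizing hull containing $\Omega$. Let $E^f$ be the free evolution of $E$, i.e. the maximal minimizer of $(P_\emptyset)$ (no obstacle), and let $E^c$ be the constrained evolution of $E$, i.e. the maximal minimizer of $(P_\Omega)$. Then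 $E^f\cup\Omega\subset E^c$, where the inclusion $E^f\subset E^c$ holds up to a Lebesgue null set and $\Omega\subset E^c$ holds pointwise. -/

import Mathlib

open MeasureTheory Set

noncomputable section

namespace ObstacleFlow

/-- Euclidean space `ℝⁿ`. -/
abbrev Rn (n : ℕ) : Type := EuclideanSpace ℝ (Fin n)

/-- Divergence `∑ᵢ ∂ᵢ φᵢ` of a vector field. -/
def divergence {n : ℕ} (φ : Rn n → Rn n) (x : Rn n) : ℝ :=
  ∑ i : Fin n, (fderiv ℝ φ x (EuclideanSpace.single i 1)) i

/-- De Giorgi's perimeter in `ℝⁿ`, with values in `[0, ∞]`: the supremum of `∫_E div φ` over all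
`C¹` vector fields `φ` with compact support and `|φ| ≤ 1`. -/
def perimeter {n : ℕ} (E : Set (Rn n)) : ENNReal :=
  ⨆ (φ : Rn n → Rn n) (_ : ContDiff ℝ 1 φ) (_ : HasCompactSupport φ) (_ : ∀ x, ‖φ x‖ ≤ 1),
    ENNReal.ofReal (∫ x in E, divergence φ x)

/-- Lebesgue measurable sets of finite perimeter. -/
def FinitePerimeter {n : ℕ} (E : Set (Rn n)) : Prop :=
  NullMeasurableSet E volume ∧ perimeter E < ⊤

/-- Signed distance to `E`, positive outside `E` and negative inside. At each point one of the two
terms vanishes. It is extended-real valued, so that the distance to the empty set is `+∞`. -/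
def signedDistance {n : ℕ} (E : Set (Rn n)) (x : Rn n) : EReal :=
  (Metric.infEDist x E : EReal) - (Metric.infEDist x Eᶜ : EReal)

/-- The energy `Per(F) + (1/h) ∫_{F Δ E} |d_E|` of one step of the scheme starting from `E`. -/
def energy {n : ℕ} (h : ℝ) (E F : Set (Rn n)) : ENNReal :=
  perimeter F + ENNReal.ofReal (1 / h) * ∫⁻ x in symmDiff F E, (signedDistance E x).abs

/-- `F` minimizes the energy among the sets of finite perimeter that contain the obstacle `Ω`. -/
def IsMinimizer {n : ℕ} (h : ℝ) (Ω E F : Set (Rn n)) : Prop :=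
  FinitePerimeter F ∧ Ω ⊆ F ∧
    ∀ G : Set (Rn n), FinitePerimeter G → Ω ⊆ G → energy h E F ≤ energy h E G

/-- `F` is the maximal minimizer: it contains every other minimizer. The energy does not see
Lebesgue null sets, so this inclusion is up to a null set. -/
def IsMaximalMinimizer {n : ℕ} (h : ℝ) (Ω E F : Set (Rn n)) : Prop :=
  IsMinimizer h Ω E F ∧ ∀ G : Set (Rn n), IsMinimizer h Ω E G → G ≤ᵐ[volume] F

/-- Minimizing hulls: the boundary is Lebesgue null, and adding a compact set never decreases the
perimeter. -/
def IsMinimizingHull {n : ℕ} (E : Set (Rn n)) : Prop :=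
  volume (frontier E) = 0 ∧
    ∀ F : Set (Rn n), E ⊆ F → IsCompact (F \ E) → perimeter E ≤ perimeter F

end ObstacleFlow

end

/-!
The energy is submodular, so if `F₁` minimizes it with obstacle `Ω₁` and `F₂` with obstacle
`Ω₂ ⊇ Ω₁`, then comparing `F₁` with `F₁ ∩ F₂` shows that `F₁ ∪ F₂` has at most the energy of `F₂`.
Hence `F₁ ∪ F₂` also minimizes with obstacle `Ω₂`, and maximality of `F₂` gives `F₁ ⊆ F₂` up to a
null set.

The bulk term is modular: it is the measure of `F Δ E` for the measure with density `|d_E|`, for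
which `E` is null measurable because `d_E` vanishes on `∂E`.

For the perimeter, let `u, v : ℝⁿ → [0, 1]` be `C¹` and let `φ, ψ` be test fields. The convex
combinations `X = ψ + v (φ - ψ)` and `Y = ψ + u (φ - ψ)` are again test fields and
`u div X + v div Y = u v div φ + (u + v - u v) div ψ + div (u v (φ - ψ))`.
Integrating bounds the total variation of `u v` plus that of `u + v - u v` by that of `u` plus that
of `v`; mollification carries this over to indicator functions, for which `u v` and `u + v - u v`
are the indicators of the intersection and the union.
-/

noncomputable section

namespace ObstacleFlow

open Filter Topology ContinuousLinearMap
open scoped Convolution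

section DivergenceTheorem

lemma integral_fderiv_apply_eq_zero {E F : Type*} [NormedAddCommGroup E] [NormedSpace ℝ E]
    [FiniteDimensional ℝ E] [MeasurableSpace E] [BorelSpace E] (μ : Measure E) [μ.IsAddHaarMeasure]
    [NormedAddCommGroup F] [NormedSpace ℝ F] {φ : E → F} (hφ : ContDiff ℝ 1 φ)
    (hc : HasCompactSupport φ) (v : E) : ∫ x, fderiv ℝ φ x v ∂μ = 0 := by
  have := hφ.continuous_fderiv one_ne_zero
  have hint : Integrable (fun x => fderiv ℝ φ x v) μ :=
    Continuous.integrable_of_hasCompactSupport (by fun_prop) (hc.fderiv_apply ℝ v)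
  simpa using integral_smul_fderiv_eq_neg_fderiv_smul_of_integrable (f := fun _ => (1 : ℝ))
    (v := v) (by simp) (by simpa using hint)
    (by simpa using hφ.continuous.integrable_of_hasCompactSupport hc)
    (fun x _ => differentiableAt_const _) (fun x _ => hφ.differentiable one_ne_zero x)

variable {n : ℕ} {f : Rn n → ℝ} {φ ψ : Rn n → Rn n} {x : Rn n}

lemma divergence_add (hφ : DifferentiableAt ℝ φ x) (hψ : DifferentiableAt ℝ ψ x) :
    divergence (fun y => φ y + ψ y) x = divergence φ x + divergence ψ x := by
  simp [divergence, fderiv_fun_add hφ hψ, Finset.sum_add_distrib]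

lemma divergence_sub (hφ : DifferentiableAt ℝ φ x) (hψ : DifferentiableAt ℝ ψ x) :
    divergence (fun y => φ y - ψ y) x = divergence φ x - divergence ψ x := by
  simp [divergence, fderiv_fun_sub hφ hψ]

lemma divergence_smul (hf : DifferentiableAt ℝ f x) (hφ : DifferentiableAt ℝ φ x) :
    divergence (fun y => f y • φ y) x = f x * divergence φ x + fderiv ℝ f x (φ x) := by
  have fderiv_eq_sum : fderiv ℝ f x (φ x) =
      ∑ i, fderiv ℝ f x (EuclideanSpace.single i 1) * φ x i := by
    conv_lhs => rw [← (EuclideanSpace.basisFun (Fin n) ℝ).sum_repr (φ x)]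
    simp [mul_comm]
  simp [divergence, fderiv_fun_smul hf hφ, Finset.sum_add_distrib, Finset.mul_sum, fderiv_eq_sum]

lemma divergence_comp_add_right (φ : Rn n → Rn n) (t x : Rn n) :
    divergence (fun y => φ (y + t)) x = divergence φ (x + t) := by
  simp [divergence, fderiv_comp_add_right]

lemma continuous_divergence (hφ : ContDiff ℝ 1 φ) : Continuous (divergence φ) := by
  have := hφ.continuous_fderiv one_ne_zero
  unfold divergence
  fun_prop

lemma hasCompactSupport_divergence (hc : HasCompactSupport φ) :
    HasCompactSupport (divergence φ) :=
  (hc.fderiv ℝ).mono fun x hx hx0 => hx (by simp [divergence, hx0])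

lemma integrable_mul_divergence (hf : Continuous f) (hφ : ContDiff ℝ 1 φ)
    (hc : HasCompactSupport φ) : Integrable fun x => f x * divergence φ x :=
  (hf.mul (continuous_divergence hφ)).integrable_of_hasCompactSupport
    (hasCompactSupport_divergence hc).mul_left

lemma integrable_divergence (hφ : ContDiff ℝ 1 φ) (hc : HasCompactSupport φ) :
    Integrable (divergence φ) :=
  (continuous_divergence hφ).integrable_of_hasCompactSupport (hasCompactSupport_divergence hc)

lemma integral_divergence_eq_zero (hφ : ContDiff ℝ 1 φ) (hc : HasCompactSupport φ) :
    ∫ x, divergence φ x = 0 := by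
  have := hφ.continuous_fderiv one_ne_zero
  have hint (i : Fin n) : Integrable fun x => fderiv ℝ φ x (EuclideanSpace.single i 1) :=
    Continuous.integrable_of_hasCompactSupport (by fun_prop) (hc.fderiv_apply ℝ _)
  have hint_coord (i : Fin n) : Integrable fun x => (fderiv ℝ φ x (EuclideanSpace.single i 1)) i :=
    (EuclideanSpace.proj i : Rn n →L[ℝ] ℝ).integrable_comp (hint i)
  have integral_coord (i : Fin n) : ∫ x, (fderiv ℝ φ x (EuclideanSpace.single i 1)) i = 0 := by
    have := (EuclideanSpace.proj i : Rn n →L[ℝ] ℝ).integral_comp_comm (hint i)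
    rwa [integral_fderiv_apply_eq_zero volume hφ hc, map_zero] at this
  unfold divergence
  rw [integral_finsetSum _ fun i _ => hint_coord i]
  exact Finset.sum_eq_zero fun i _ => integral_coord i

end DivergenceTheorem

section TestField

variable {n : ℕ}

/-- The admissible fields in the definition of the perimeter: `C¹`, compactly supported and of
Euclidean norm at most `1`. -/
structure IsTestField (φ : Rn n → Rn n) : Prop where
  contDiff : ContDiff ℝ 1 φ
  hasCompactSupport : HasCompactSupport φ
  norm_le_one : ∀ x, ‖φ x‖ ≤ 1

variable {φ ψ : Rn n → Rn n}

lemma isTestField_zero : IsTestField (0 : Rn n → Rn n) :=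
  ⟨contDiff_const, HasCompactSupport.zero, by simp⟩

lemma IsTestField.comp_add_right (hφ : IsTestField φ) (t : Rn n) :
    IsTestField fun x => φ (x + t) :=
  ⟨hφ.contDiff.comp (contDiff_id.add contDiff_const),
    hφ.hasCompactSupport.comp_homeomorph (Homeomorph.addRight t), fun _ => hφ.norm_le_one _⟩

lemma IsTestField.add_smul_sub (hφ : IsTestField φ) (hψ : IsTestField ψ) {s : Rn n → ℝ}
    (hs : ContDiff ℝ 1 s) (hs01 : ∀ x, s x ∈ Icc 0 1) :
    IsTestField fun x => ψ x + s x • (φ x - ψ x) where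
  contDiff := hψ.contDiff.add (hs.smul (hφ.contDiff.sub hψ.contDiff))
  hasCompactSupport :=
    hψ.hasCompactSupport.add ((hφ.hasCompactSupport.sub hψ.hasCompactSupport).smul_left (f := s))
  norm_le_one x := by
    simpa using (convex_closedBall (0 : Rn n) 1).add_smul_sub_mem
      (mem_closedBall_zero_iff.2 (hψ.norm_le_one x)) (mem_closedBall_zero_iff.2 (hφ.norm_le_one x))
      (hs01 x)

end TestField

section TotalVariation

variable {n : ℕ}

/-- The total variation of `f`, in the distributional sense, with values in `[0, ∞]`; the perimeter
of a set is the total variation of its indicator function. It is meant for locally integrable `f`,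
as the integrals below are otherwise `0` by convention. -/
def totalVariation (f : Rn n → ℝ) : ENNReal :=
  ⨆ (φ : Rn n → Rn n) (_ : IsTestField φ), ENNReal.ofReal (∫ x, f x * divergence φ x)

variable {f g : Rn n → ℝ} {φ ψ : Rn n → Rn n}

lemma IsTestField.ofReal_integral_le_totalVariation (hφ : IsTestField φ) (f : Rn n → ℝ) :
    ENNReal.ofReal (∫ x, f x * divergence φ x) ≤ totalVariation f :=
  le_iSup₂ (f := fun φ (_ : IsTestField φ) => ENNReal.ofReal (∫ x, f x * divergence φ x)) φ hφ

lemma perimeter_eq_totalVariation_indicator {A : Set (Rn n)} (hA : NullMeasurableSet A volume) :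
    perimeter A = totalVariation (A.indicator 1) := by
  have setIntegral_eq (φ : Rn n → Rn n) :
      ∫ x in A, divergence φ x = ∫ x, A.indicator 1 x * divergence φ x := by
    rw [← integral_indicator₀ hA]
    refine integral_congr_ae (ae_of_all _ fun x => ?_)
    by_cases hx : x ∈ A <;> simp [hx]
  simp only [perimeter, totalVariation, setIntegral_eq]
  refine iSup_congr fun φ => le_antisymm ?_ ?_
  · exact iSup_le fun h₁ => iSup_le fun h₂ => iSup_le fun h₃ => le_iSup_of_le ⟨h₁, h₂, h₃⟩ le_rfl
  · exact iSup_le fun h =>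
      le_iSup_of_le h.1 (le_iSup_of_le h.2 (le_iSup_of_le h.3 le_rfl))

lemma IsTestField.exists_integral_eq_max (hφ : IsTestField φ) (f : Rn n → ℝ) :
    ∃ φ', IsTestField φ' ∧ ∫ x, f x * divergence φ' x = max (∫ x, f x * divergence φ x) 0 := by
  rcases le_total 0 (∫ x, f x * divergence φ x) with h | h
  · exact ⟨φ, hφ, (max_eq_left h).symm⟩
  · exact ⟨0, isTestField_zero, by rw [max_eq_right h]; simp [divergence]⟩

lemma totalVariation_add_totalVariation_le {C : ENNReal}
    (h : ∀ φ ψ, IsTestField φ → IsTestField ψ →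
      ENNReal.ofReal ((∫ x, f x * divergence φ x) + ∫ x, g x * divergence ψ x) ≤ C) :
    totalVariation f + totalVariation g ≤ C := by
  refine ENNReal.biSup_add_biSup_le' ⟨0, isTestField_zero⟩ ⟨0, isTestField_zero⟩
    fun φ hφ ψ hψ => ?_
  obtain ⟨φ', hφ', hφ_max⟩ := hφ.exists_integral_eq_max f
  obtain ⟨ψ', hψ', hψ_max⟩ := hψ.exists_integral_eq_max g
  calc ENNReal.ofReal (∫ x, f x * divergence φ x) + ENNReal.ofReal (∫ x, g x * divergence ψ x)
      = ENNReal.ofReal ((∫ x, f x * divergence φ' x) + ∫ x, g x * divergence ψ' x) := by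
        rw [hφ_max, hψ_max, ENNReal.ofReal_add (le_max_right _ _) (le_max_right _ _)]
        simp [ENNReal.ofReal_max]
    _ ≤ C := h φ' ψ' hφ' hψ'

lemma IsTestField.tendsto_integral_mul_divergence (hφ : IsTestField φ) {u : ℕ → Rn n → ℝ} {C : ℝ}
    (hu : ∀ k, AEStronglyMeasurable (u k)) (hC : ∀ k x, ‖u k x‖ ≤ C)
    (hlim : ∀ᵐ x, Tendsto (fun k => u k x) atTop (𝓝 (f x))) :
    Tendsto (fun k => ∫ x, u k x * divergence φ x) atTop (𝓝 (∫ x, f x * divergence φ x)) := by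
  have hdiv := integrable_divergence hφ.contDiff hφ.hasCompactSupport
  refine tendsto_integral_of_dominated_convergence (fun x => C * ‖divergence φ x‖)
    (fun k => (hu k).mul hdiv.aestronglyMeasurable) (hdiv.norm.const_mul C)
    (fun k => ae_of_all _ fun x => ?_) (hlim.mono fun x hx => hx.mul_const _)
  rw [norm_mul]
  gcongr
  exact hC k x

end TotalVariation

section Mollification

variable {n : ℕ} {ρ f : Rn n → ℝ}

lemma integral_comp_sub_mul_divergence (f : Rn n → ℝ) (φ : Rn n → Rn n) (t : Rn n) :
    ∫ x, f (x - t) * divergence φ x = ∫ x, f x * divergence (fun y => φ (y + t)) x := by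
  rw [← integral_add_right_eq_self _ t]
  simp only [add_sub_cancel_right, divergence_comp_add_right]

lemma convolution_mem_Icc {a b : ℝ} (hρ : Integrable ρ) (hρ0 : ∀ x, 0 ≤ ρ x) (hρ1 : ∫ x, ρ x = 1)
    (hf : AEStronglyMeasurable f) (hfab : ∀ x, f x ∈ Icc a b) (x : Rn n) :
    (ρ ⋆[lsmul ℝ ℝ] f) x ∈ Icc a b := by
  have hint : Integrable fun t => ρ t * f (x - t) :=
    hρ.mul_bdd (c := max |a| |b|)
      (hf.comp_quasiMeasurePreserving (quasiMeasurePreserving_sub_left_of_right_invariant volume x))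
      (ae_of_all _ fun t => abs_le_max_abs_abs (hfab _).1 (hfab _).2)
  have integral_mul_eq (c : ℝ) : ∫ t, ρ t * c = c := by rw [integral_mul_const, hρ1, one_mul]
  constructor
  · rw [← integral_mul_eq a]
    exact integral_mono (hρ.mul_const a) hint fun t =>
      mul_le_mul_of_nonneg_left (hfab _).1 (hρ0 t)
  · rw [← integral_mul_eq b]
    exact integral_mono hint (hρ.mul_const b) fun t =>
      mul_le_mul_of_nonneg_left (hfab _).2 (hρ0 t)

lemma integral_convolution_mul_divergence (hρ : Integrable ρ) (hf : AEStronglyMeasurable f) {C : ℝ}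
    (hC : ∀ x, ‖f x‖ ≤ C) {φ : Rn n → Rn n} (hφ : IsTestField φ) :
    Integrable (fun t => ρ t * ∫ x, f (x - t) * divergence φ x) ∧
      ∫ x, (ρ ⋆[lsmul ℝ ℝ] f) x * divergence φ x =
        ∫ t, ρ t * ∫ x, f (x - t) * divergence φ x := by
  have hprod : Integrable (Function.uncurry fun x t => ρ t * (f (x - t) * divergence φ x))
      ((volume : Measure (Rn n)).prod volume) := by
    refine (((integrable_divergence hφ.contDiff hφ.hasCompactSupport).mul_prod hρ).bdd_mul
      (hf.comp_quasiMeasurePreserving (quasiMeasurePreserving_sub_of_right_invariant _ _))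
      (ae_of_all _ fun p => hC (p.1 - p.2))).congr (ae_of_all _ fun p => ?_)
    simp only [Function.uncurry, Function.comp_apply]
    ring
  constructor
  · simpa only [Function.uncurry, integral_const_mul] using hprod.integral_prod_right
  · calc ∫ x, (ρ ⋆[lsmul ℝ ℝ] f) x * divergence φ x
        = ∫ x, ∫ t, ρ t * (f (x - t) * divergence φ x) := by
          simp only [convolution, lsmul_apply, smul_eq_mul, ← integral_mul_const, mul_assoc]
      _ = ∫ t, ∫ x, ρ t * (f (x - t) * divergence φ x) := integral_integral_swap hprod
      _ = ∫ t, ρ t * ∫ x, f (x - t) * divergence φ x := by simp only [integral_const_mul]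

lemma totalVariation_convolution_le (hρ : Integrable ρ) (hρ0 : ∀ x, 0 ≤ ρ x) (hρ1 : ∫ x, ρ x = 1)
    (hf : AEStronglyMeasurable f) {C : ℝ} (hC : ∀ x, ‖f x‖ ≤ C) :
    totalVariation (ρ ⋆[lsmul ℝ ℝ] f) ≤ totalVariation f := by
  by_cases htop : totalVariation f = ⊤
  · simp [htop]
  refine iSup₂_le fun φ hφ => ?_
  obtain ⟨hint, integral_eq⟩ := integral_convolution_mul_divergence hρ hf hC hφ
  have translate_le (t : Rn n) :
      ∫ x, f (x - t) * divergence φ x ≤ (totalVariation f).toReal := by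
    rw [integral_comp_sub_mul_divergence, ← ENNReal.ofReal_le_iff_le_toReal htop]
    exact (hφ.comp_add_right t).ofReal_integral_le_totalVariation f
  rw [ENNReal.ofReal_le_iff_le_toReal htop, integral_eq]
  calc ∫ t, ρ t * ∫ x, f (x - t) * divergence φ x
      ≤ ∫ t, ρ t * (totalVariation f).toReal :=
        integral_mono hint (hρ.mul_const _) fun t =>
          mul_le_mul_of_nonneg_left (translate_le t) (hρ0 t)
    _ = (totalVariation f).toReal := by rw [integral_mul_const, hρ1, one_mul]

lemma exists_contDiff_approximation {a b : ℝ} (hf : AEStronglyMeasurable f)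
    (hfab : ∀ x, f x ∈ Icc a b) :
    ∃ u : ℕ → Rn n → ℝ, (∀ k, ContDiff ℝ 1 (u k)) ∧ (∀ k x, u k x ∈ Icc a b) ∧
      (∀ k, totalVariation (u k) ≤ totalVariation f) ∧
      ∀ᵐ x, Tendsto (fun k => u k x) atTop (𝓝 (f x)) := by
  let ρ (k : ℕ) : ContDiffBump (0 : Rn n) :=
    { rIn := 1 / ((k : ℝ) + 1)
      rOut := 2 * (1 / ((k : ℝ) + 1))
      rIn_pos := Nat.one_div_pos_of_nat
      rIn_lt_rOut := lt_two_mul_self Nat.one_div_pos_of_nat }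
  have hρ (k : ℕ) : Integrable ((ρ k).normed volume) := (ρ k).integrable_normed
  have norm_le (x : Rn n) : ‖f x‖ ≤ max |a| |b| := abs_le_max_abs_abs (hfab x).1 (hfab x).2
  have hf_loc : LocallyIntegrable f volume :=
    (locallyIntegrable_const (max |a| |b|)).mono hf
      (ae_of_all _ fun x => (norm_le x).trans (le_abs_self _))
  refine ⟨fun k => (ρ k).normed volume ⋆[lsmul ℝ ℝ] f, fun k => ?_,
    fun k => convolution_mem_Icc (hρ k) (ρ k).nonneg_normed (ρ k).integral_normed hf hfab,
    fun k => totalVariation_convolution_le (hρ k) (ρ k).nonneg_normed (ρ k).integral_normed hf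
      norm_le, ?_⟩
  · exact (ρ k).hasCompactSupport_normed.contDiff_convolution_left _ (ρ k).contDiff_normed hf_loc
  · refine ContDiffBump.ae_convolution_tendsto_right_of_locallyIntegrable (K := 2) ?_
      (Eventually.of_forall fun k => le_rfl) hf_loc
    simpa [ρ] using (tendsto_one_div_add_atTop_nhds_zero_nat (𝕜 := ℝ)).const_mul 2

end Mollification

section Submodularity

variable {n : ℕ} {f g u v : Rn n → ℝ} {φ ψ : Rn n → Rn n}

lemma mul_divergence_add_smul_sub {x : Rn n} (hu : DifferentiableAt ℝ u x)
    (hv : DifferentiableAt ℝ v x) (hφ : DifferentiableAt ℝ φ x) (hψ : DifferentiableAt ℝ ψ x) :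
    u x * divergence (fun y => ψ y + v y • (φ y - ψ y)) x +
        v x * divergence (fun y => ψ y + u y • (φ y - ψ y)) x =
      (u * v) x * divergence φ x + (u + v - u * v) x * divergence ψ x +
        divergence (fun y => (u y * v y) • (φ y - ψ y)) x := by
  have hw : DifferentiableAt ℝ (fun y => φ y - ψ y) x := hφ.fun_sub hψ
  rw [divergence_add hψ (hv.fun_smul hw), divergence_add hψ (hu.fun_smul hw),
    divergence_smul hv hw, divergence_smul hu hw, divergence_smul (hu.fun_mul hv) hw,
    divergence_sub hφ hψ, fderiv_fun_mul hu hv]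
  simp only [add_apply, smul_apply, smul_eq_mul, Pi.mul_apply, Pi.add_apply, Pi.sub_apply]
  ring

lemma integral_mul_divergence_add_smul_sub (hu : ContDiff ℝ 1 u) (hv : ContDiff ℝ 1 v)
    (hφ : ContDiff ℝ 1 φ) (hφc : HasCompactSupport φ)
    (hψ : ContDiff ℝ 1 ψ) (hψc : HasCompactSupport ψ) :
    (∫ x, u x * divergence (fun y => ψ y + v y • (φ y - ψ y)) x) +
        ∫ x, v x * divergence (fun y => ψ y + u y • (φ y - ψ y)) x =
      (∫ x, (u * v) x * divergence φ x) + ∫ x, (u + v - u * v) x * divergence ψ x := by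
  have hsub {s : Rn n → ℝ} (hs : ContDiff ℝ 1 s) : ContDiff ℝ 1 fun y => s y • (φ y - ψ y) :=
    hs.smul (hφ.sub hψ)
  have hsubc (s : Rn n → ℝ) : HasCompactSupport fun y => s y • (φ y - ψ y) :=
    (hφc.sub hψc).smul_left (f := s)
  have hX_int := integrable_mul_divergence hu.continuous (hψ.add (hsub hv)) (hψc.add (hsubc v))
  have hY_int := integrable_mul_divergence hv.continuous (hψ.add (hsub hu)) (hψc.add (hsubc u))
  have hφ_int : Integrable fun x => (u * v) x * divergence φ x :=
    integrable_mul_divergence (hu.mul hv).continuous hφ hφc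
  have hψ_int : Integrable fun x => (u + v - u * v) x * divergence ψ x :=
    integrable_mul_divergence ((hu.add hv).sub (hu.mul hv)).continuous hψ hψc
  have huv : ContDiff ℝ 1 fun y => (u y * v y) • (φ y - ψ y) := hsub (hu.mul hv)
  have huvc : HasCompactSupport fun y => (u y * v y) • (φ y - ψ y) := hsubc (u * v)
  calc (∫ x, u x * divergence (fun y => ψ y + v y • (φ y - ψ y)) x) +
        ∫ x, v x * divergence (fun y => ψ y + u y • (φ y - ψ y)) x
      = ∫ x, (u x * divergence (fun y => ψ y + v y • (φ y - ψ y)) x +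
          v x * divergence (fun y => ψ y + u y • (φ y - ψ y)) x) :=
        (integral_add hX_int hY_int).symm
    _ = ∫ x, ((u * v) x * divergence φ x + (u + v - u * v) x * divergence ψ x +
          divergence (fun y => (u y * v y) • (φ y - ψ y)) x) :=
        integral_congr_ae <| ae_of_all _ fun x =>
          mul_divergence_add_smul_sub (hu.differentiable one_ne_zero x)
            (hv.differentiable one_ne_zero x) (hφ.differentiable one_ne_zero x)
            (hψ.differentiable one_ne_zero x)
    _ = (∫ x, (u * v) x * divergence φ x) + ∫ x, (u + v - u * v) x * divergence ψ x := by
        rw [integral_add (hφ_int.fun_add hψ_int) (integrable_divergence huv huvc),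
          integral_divergence_eq_zero huv huvc, add_zero, integral_add hφ_int hψ_int]

lemma ofReal_integral_mul_divergence_add_le (hu : ContDiff ℝ 1 u) (hv : ContDiff ℝ 1 v)
    (hu01 : ∀ x, u x ∈ Icc 0 1) (hv01 : ∀ x, v x ∈ Icc 0 1)
    (hφ : IsTestField φ) (hψ : IsTestField ψ) :
    ENNReal.ofReal ((∫ x, (u * v) x * divergence φ x) +
        ∫ x, (u + v - u * v) x * divergence ψ x) ≤ totalVariation u + totalVariation v := by
  rw [← integral_mul_divergence_add_smul_sub hu hv hφ.contDiff hφ.hasCompactSupport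
    hψ.contDiff hψ.hasCompactSupport]
  exact ENNReal.ofReal_add_le.trans <| add_le_add
    ((hφ.add_smul_sub hψ hv hv01).ofReal_integral_le_totalVariation u)
    ((hφ.add_smul_sub hψ hu hu01).ofReal_integral_le_totalVariation v)

theorem totalVariation_mul_add_totalVariation_add_sub_mul_le (hf : AEStronglyMeasurable f)
    (hg : AEStronglyMeasurable g) (hf01 : ∀ x, f x ∈ Icc 0 1) (hg01 : ∀ x, g x ∈ Icc 0 1) :
    totalVariation (f * g) + totalVariation (f + g - f * g) ≤
      totalVariation f + totalVariation g := by
  obtain ⟨u, hu, hu01, hu_le, hu_lim⟩ := exists_contDiff_approximation hf hf01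
  obtain ⟨v, hv, hv01, hv_le, hv_lim⟩ := exists_contDiff_approximation hg hg01
  refine totalVariation_add_totalVariation_le fun φ ψ hφ hψ => ?_
  have mul_lim : Tendsto (fun k => ∫ x, (u k * v k) x * divergence φ x) atTop
      (𝓝 (∫ x, (f * g) x * divergence φ x)) := by
    refine hφ.tendsto_integral_mul_divergence (C := 1)
      (fun k => ((hu k).mul (hv k)).continuous.aestronglyMeasurable) (fun k x => ?_) ?_
    · have := unitInterval.mul_mem (hu01 k x) (hv01 k x)
      exact abs_le.2 ⟨neg_one_lt_zero.le.trans this.1, this.2⟩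
    · filter_upwards [hu_lim, hv_lim] with x hux hvx using hux.mul hvx
  have add_sub_mul_lim : Tendsto (fun k => ∫ x, (u k + v k - u k * v k) x * divergence ψ x) atTop
      (𝓝 (∫ x, (f + g - f * g) x * divergence ψ x)) := by
    refine hψ.tendsto_integral_mul_divergence (C := 1)
      (fun k => (((hu k).add (hv k)).sub ((hu k).mul (hv k))).continuous.aestronglyMeasurable)
      (fun k x => ?_) ?_
    · obtain ⟨hu0, hu1⟩ := hu01 k x
      obtain ⟨hv0, hv1⟩ := hv01 k x
      simp only [Pi.sub_apply, Pi.add_apply, Pi.mul_apply]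
      exact abs_le.2 ⟨by nlinarith, by nlinarith⟩
    · filter_upwards [hu_lim, hv_lim] with x hux hvx using (hux.add hvx).sub (hux.mul hvx)
  exact le_of_tendsto' (ENNReal.tendsto_ofReal (mul_lim.add add_sub_mul_lim)) fun k =>
    (ofReal_integral_mul_divergence_add_le (hu k) (hv k) (hu01 k) (hv01 k) hφ hψ).trans
      (add_le_add (hu_le k) (hv_le k))

theorem perimeter_inter_add_perimeter_union_le {A B : Set (Rn n)}
    (hA : NullMeasurableSet A volume) (hB : NullMeasurableSet B volume) :
    perimeter (A ∩ B) + perimeter (A ∪ B) ≤ perimeter A + perimeter B := by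
  have indicator_mem (C : Set (Rn n)) (x : Rn n) : C.indicator (1 : Rn n → ℝ) x ∈ Icc 0 1 := by
    by_cases hx : x ∈ C <;> simp [hx]
  have union_indicator : (A ∪ B).indicator (1 : Rn n → ℝ) =
      A.indicator 1 + B.indicator 1 - A.indicator 1 * B.indicator 1 := by
    rw [← inter_indicator_one, eq_sub_iff_add_eq, indicator_union_add_inter]
  rw [perimeter_eq_totalVariation_indicator (hA.inter hB),
    perimeter_eq_totalVariation_indicator (hA.union hB), perimeter_eq_totalVariation_indicator hA,
    perimeter_eq_totalVariation_indicator hB, inter_indicator_one, union_indicator]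
  exact totalVariation_mul_add_totalVariation_add_sub_mul_le
    (aestronglyMeasurable_one.indicator₀ hA) (aestronglyMeasurable_one.indicator₀ hB)
    (indicator_mem A) (indicator_mem B)

variable {A B : Set (Rn n)}

lemma FinitePerimeter.inter (hA : FinitePerimeter A) (hB : FinitePerimeter B) :
    FinitePerimeter (A ∩ B) :=
  ⟨hA.1.inter hB.1, (le_self_add.trans (perimeter_inter_add_perimeter_union_le hA.1 hB.1)).trans_lt
    (ENNReal.add_lt_top.2 ⟨hA.2, hB.2⟩)⟩

lemma FinitePerimeter.union (hA : FinitePerimeter A) (hB : FinitePerimeter B) :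
    FinitePerimeter (A ∪ B) :=
  ⟨hA.1.union hB.1, (le_add_self.trans (perimeter_inter_add_perimeter_union_le hA.1 hB.1)).trans_lt
    (ENNReal.add_lt_top.2 ⟨hA.2, hB.2⟩)⟩

end Submodularity

section Energy

lemma measure_inter_symmDiff_add_measure_union_symmDiff {α : Type*} [MeasurableSpace α]
    {μ : Measure α} {A B E : Set α} (hA : NullMeasurableSet A μ) (hB : NullMeasurableSet B μ)
    (hE : NullMeasurableSet E μ) :
    μ (symmDiff (A ∩ B) E) + μ (symmDiff (A ∪ B) E) = μ (symmDiff A E) + μ (symmDiff B E) := by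
  have gain : μ ((A ∩ B) \ E) + μ ((A ∪ B) \ E) = μ (A \ E) + μ (B \ E) := by
    rw [sdiff_inter_distrib_right, union_sdiff_distrib, add_comm,
      measure_union_add_inter₀ _ (hB.diff hE)]
  have loss : μ (E \ (A ∩ B)) + μ (E \ (A ∪ B)) = μ (E \ A) + μ (E \ B) := by
    rw [sdiff_inter, ← sdiff_inter_sdiff, measure_union_add_inter₀ _ (hE.diff hB)]
  rw [measure_symmDiff_eq (hA.inter hB) hE, measure_symmDiff_eq (hA.union hB) hE,
    measure_symmDiff_eq hA hE, measure_symmDiff_eq hB hE, add_add_add_comm, gain, loss,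
    add_add_add_comm]

variable {n : ℕ}

/-- The measure with density `|d_E|`, which turns the bulk term of the energy into the measure of
a symmetric difference. -/
def distanceMeasure (E : Set (Rn n)) : Measure (Rn n) :=
  volume.withDensity fun x => (signedDistance E x).abs

lemma signedDistance_eq_zero_of_mem_frontier {E : Set (Rn n)} {x : Rn n} (hx : x ∈ frontier E) :
    signedDistance E x = 0 := by
  rw [frontier_eq_closure_inter_closure] at hx
  simp [signedDistance, Metric.mem_closure_iff_infEDist_zero.1 hx.1,
    Metric.mem_closure_iff_infEDist_zero.1 hx.2]

lemma distanceMeasure_frontier (E : Set (Rn n)) : distanceMeasure E (frontier E) = 0 := by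
  rw [distanceMeasure, withDensity_apply']
  exact setLIntegral_eq_zero isClosed_frontier.measurableSet fun x hx => by
    simp [signedDistance_eq_zero_of_mem_frontier hx]

lemma energy_eq_perimeter_add_distanceMeasure (h : ℝ) (E F : Set (Rn n)) :
    energy h E F = perimeter F + ENNReal.ofReal (1 / h) * distanceMeasure E (symmDiff F E) := by
  rw [energy, distanceMeasure, withDensity_apply']

theorem energy_inter_add_energy_union_le (h : ℝ) (E : Set (Rn n)) {A B : Set (Rn n)}
    (hA : NullMeasurableSet A volume) (hB : NullMeasurableSet B volume) :
    energy h E (A ∩ B) + energy h E (A ∪ B) ≤ energy h E A + energy h E B := by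
  have hac : distanceMeasure E ≪ volume := withDensity_absolutelyContinuous _ _
  have hE : NullMeasurableSet E (distanceMeasure E) :=
    nullMeasurableSet_of_null_frontier (distanceMeasure_frontier E)
  simp only [energy_eq_perimeter_add_distanceMeasure]
  rw [add_add_add_comm, add_add_add_comm (perimeter A), ← mul_add, ← mul_add,
    measure_inter_symmDiff_add_measure_union_symmDiff (hA.mono_ac hac) (hB.mono_ac hac) hE]
  gcongr ?_ + _
  exact perimeter_inter_add_perimeter_union_le hA hB

lemma IsMinimizer.union {h : ℝ} {Ω₁ Ω₂ E F₁ F₂ : Set (Rn n)} (hΩ : Ω₁ ⊆ Ω₂)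
    (h₁ : IsMinimizer h Ω₁ E F₁) (h₂ : IsMinimizer h Ω₂ E F₂) :
    IsMinimizer h Ω₂ E (F₁ ∪ F₂) := by
  obtain ⟨hF₁, hΩF₁, hmin₁⟩ := h₁
  obtain ⟨hF₂, hΩF₂, hmin₂⟩ := h₂
  have energy_le : energy h E (F₁ ∪ F₂) ≤ energy h E F₂ := by
    by_cases htop : energy h E F₂ = ⊤
    · exact htop ▸ le_top
    have hF₁_top : energy h E F₁ ≠ ⊤ := ne_top_of_le_ne_top htop (hmin₁ F₂ hF₂ (hΩ.trans hΩF₂))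
    refine (ENNReal.add_le_add_iff_left hF₁_top).1 ?_
    calc energy h E F₁ + energy h E (F₁ ∪ F₂)
        ≤ energy h E (F₁ ∩ F₂) + energy h E (F₁ ∪ F₂) := by
          gcongr
          exact hmin₁ _ (hF₁.inter hF₂) (subset_inter hΩF₁ (hΩ.trans hΩF₂))
      _ ≤ energy h E F₁ + energy h E F₂ := energy_inter_add_energy_union_le h E hF₁.1 hF₂.1
  exact ⟨hF₁.union hF₂, hΩF₂.trans subset_union_right,
    fun G hG hΩG => energy_le.trans (hmin₂ G hG hΩG)⟩

end Energy

end ObstacleFlow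

end

theorem mainTheorem9_general {n : ℕ} {h : ℝ} (_hh : 0 < h)
    {Ω₁ Ω₂ E F₁ F₂ : Set (ObstacleFlow.Rn n)} (hΩ : Ω₁ ⊆ Ω₂)
    (h₁ : ObstacleFlow.IsMinimizer h Ω₁ E F₁) (h₂ : ObstacleFlow.IsMaximalMinimizer h Ω₂ E F₂) :
    F₁ ≤ᵐ[MeasureTheory.volume] F₂ ∧ Ω₂ ⊆ F₂ :=
  ⟨subset_union_left.eventuallyLE.trans (h₂.2 _ (h₁.union hΩ h₂.1)), h₂.1.2.1⟩

theorem mainTheorem9 (n : ℕ) (h : ℝ) (hh : 0 < h)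
    (Ω E Ef Ec : Set (ObstacleFlow.Rn n))
    (hE : ObstacleFlow.IsMinimizingHull E) (hΩE : Ω ⊆ E)
    (hEf : ObstacleFlow.IsMaximalMinimizer h ∅ E Ef)
    (hEc : ObstacleFlow.IsMaximalMinimizer h Ω E Ec) :
    Ef ≤ᵐ[MeasureTheory.volume] Ec ∧ Ω ⊆ Ec :=
  mainTheorem9_general hh (empty_subset Ω) hEf.1 hEc
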